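/- Let $k$ be a field, $P=k[x,y]$, $R=k[[x,y]]$, and let $E\subset P$ be a zero-dimensional monomial ideal. Let $t$ be the smallest integer with $x^t\in E$ and, for $0\le i\le t$, let $m_i$ be the smallest integer with $x^{t-i}y^{m_i}\in E$, so that $0=m_0<m_1\le\dots\le m_t$ and $E=(x^t,x^{t-1}y^{m_1},\dots,y^{m_t})$. Put $d_j=m_j-m_{j-1}$ for $1\le j\le t$. Let $\overline{\tau}$ be the local order on monomials: $m>_{\overline\tau}m'$ if and only if $\deg m<\deg m'$, or $\deg m=\deg m'$ and $m>_{\mathrm{lex}}m'$ (with $x>y$). For an ideal $J\subset R$ let $\operatorname{Lt}_{\overline\tau}(J)\subset P$ be the ideal generated by the $\overline\tau$-leading monomials of the nonzero elements of $J$, and let $V(E)=\{J\subset R \text{ an ideal}: \operatorname{Lt}_{\overline\tau}(J)=E\}$. For an ideal $I\subset P$ let $\operatorname{Lt}_{\mathrm{lex}}(I)$ be its leading term ideal for the lexicographic order with $x>y$. Let $H$ be the $(t+1)\times t$ matrix with $H_{i,i}=y^{d_i}$, $H_{i+1,i}=-x$ for $1\le i\le t$ and all other entries $0$, and let $u_{i,j}=m_j-m_{i-1}+i-j$.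 Let $\mathcal N(E)$ be the set of $(t+1)\times t$ matrices $N=(n_{i,j})$ over $k[[y]]$ all of whose nonzero entries satisfy $\operatorname{ord}(n_{i,j})\ge u_{i,j}+1$ if $i\le j$ and $\operatorname{ord}(n_{i,j})\ge u_{i,j}$ if $i>j$. Let $T_0(E)$ be the set of $(t+1)\times t$ matrices over $k[y]$ with $n_{i,j}=0$ for $i<j$ and $\deg(n_{i,j})<d_j$ for $i\ge j$ (where $\deg 0=-\infty$), and let $\mathcal M(E)=\mathcal N(E)\cap T_0(E)$. For $N\in\mathcal N(E)$ let $\varphi(N)=I_t(H+N)$ be the ideal of $R$ generated by the maximal minors of $H+N$. Suppose that $E$ does not satisfy the condition $$m_j-j-1\le m_i-i\quad\text{for all } 0\le j<i\le t.$$ Then there exists $J\in V(E)$ such that $\operatorname{Lt}_{\mathrm{lex}}(J\cap P)\ne E$. More explicitly, there is a pair $(i,j)$ with $1\le j<i\le t$ such that $m_j-j-1>m_i-i$, $m_{j-1}<m_j$, and either $i=t$ or $m_i<m_{i+1}$; and for every such pair the ideal $$J=\bigl(x^{t-l}y^{m_l}\ (0\le l\le t,\ l\ne i),\ \ x^{t-i}y^{m_i}+x^{t-j}y^{m_j-1}\bigr)\subset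 R$$ satisfies $J\in V(E)$, $\operatorname{Lt}_{\mathrm{lex}}(J\cap P)\ne E$ and $J\notin\varphi(\mathcal M(E))$. Consequently $\varphi$ restricted to $\mathcal M(E)$ is not surjective onto $V(E)$. -/

import Mathlib

/-!
Throughout, `P = k[x, y]` is `MvPolynomial (Fin 2) k` and `R = k[[x, y]]` is
`MvPowerSeries (Fin 2) k`, with `x = X 0` and `y = X 1`. Exponents of monomials are
elements of `Fin 2 →₀ ℕ`.
-/

noncomputable section

namespace HilbertBurch

variable {k : Type*} [Field k]

/-! ### Leading term ideals -/

/-- An ideal of `k[x, y]` is monomial if it is generated by monomials. -/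
def IsMonomialIdeal (E : Ideal (MvPolynomial (Fin 2) k)) : Prop :=
  ∃ S : Set (Fin 2 →₀ ℕ), E = Ideal.span ((fun s => MvPolynomial.monomial s (1 : k)) '' S)

/-- The leading term ideal of an ideal of `k[x, y]` for the lexicographic order with `x > y`. -/
def ltLex (I : Ideal (MvPolynomial (Fin 2) k)) : Ideal (MvPolynomial (Fin 2) k) :=
  Ideal.span {g | ∃ f ∈ I, g = (MonomialOrder.lex (σ := Fin 2)).leadingTerm f}

/-- `LocalLT a b` means that the monomial with exponent `a` is strictly smaller than the one with
exponent `b` in the local degree order induced by the lexicographic order: `b` has smaller total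
degree, or the degrees agree and `b` is lexicographically larger. -/
def LocalLT (a b : Fin 2 →₀ ℕ) : Prop :=
  b.degree < a.degree ∨ (a.degree = b.degree ∧ toLex a < toLex b)

/-- `a` is the exponent of the leading monomial of the power series `f` for the local order. -/
def IsLocalLeadingExponent (f : MvPowerSeries (Fin 2) k) (a : Fin 2 →₀ ℕ) : Prop :=
  MvPowerSeries.coeff a f ≠ 0 ∧
    ∀ b : Fin 2 →₀ ℕ, MvPowerSeries.coeff b f ≠ 0 → b ≠ a → LocalLT b a

/-- The leading term ideal, inside `k[x, y]`, of an ideal of `k[[x, y]]` for the local order. -/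
def ltLocal (J : Ideal (MvPowerSeries (Fin 2) k)) : Ideal (MvPolynomial (Fin 2) k) :=
  Ideal.span {g | ∃ f ∈ J, ∃ a, IsLocalLeadingExponent f a ∧
    g = MvPolynomial.monomial a (1 : k)}

/-- The contraction `J ∩ k[x, y]` of an ideal `J` of `k[[x, y]]`. -/
def contract (J : Ideal (MvPowerSeries (Fin 2) k)) : Ideal (MvPolynomial (Fin 2) k) :=
  J.comap (MvPolynomial.coeToMvPowerSeries.ringHom (R := k) (σ := Fin 2))

/-- The Gröbner cell `V(E)`. -/
def cell (E : Ideal (MvPolynomial (Fin 2) k)) : Set (Ideal (MvPowerSeries (Fin 2) k)) :=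
  {J | ltLocal J = E}

/-! ### The numerical data of a monomial ideal -/

/-- The smallest `t` with `x ^ t ∈ E`. -/
def tE (E : Ideal (MvPolynomial (Fin 2) k)) : ℕ :=
  sInf {n | (MvPolynomial.X 0 ^ n : MvPolynomial (Fin 2) k) ∈ E}

/-- The smallest `m_i` with `x ^ (t - i) * y ^ m_i ∈ E`; used for `0 ≤ i ≤ t`. -/
def mE (E : Ideal (MvPolynomial (Fin 2) k)) (i : ℕ) : ℕ :=
  sInf {n | (MvPolynomial.X 0 ^ (tE E - i) * MvPolynomial.X 1 ^ n :
    MvPolynomial (Fin 2) k) ∈ E}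

/-- The condition `m_j - j - 1 ≤ m_i - i` for all `0 ≤ j < i ≤ t`. -/
def LexGBCond (E : Ideal (MvPolynomial (Fin 2) k)) : Prop :=
  ∀ i j : ℕ, j < i → i ≤ tE E → (mE E j : ℤ) - j - 1 ≤ (mE E i : ℤ) - i

/-! ### Hilbert-Burch matrices

Rows and columns are numbered from `0`, so that the entry `(i, j)` below is the entry
`(i + 1, j + 1)` in the usual numbering. -/

/-- The difference `m_{j + 1} - m_j`, which belongs to the column with index `j` from `0`. -/
def dE (E : Ideal (MvPolynomial (Fin 2) k)) (j : ℕ) : ℕ := mE E (j + 1) - mE E j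

/-- The canonical Hilbert-Burch matrix of `E`. -/
def canonicalHB (E : Ideal (MvPolynomial (Fin 2) k)) :
    Matrix (Fin (tE E + 1)) (Fin (tE E)) (MvPowerSeries (Fin 2) k) :=
  Matrix.of fun i j =>
    if i = j.castSucc then MvPowerSeries.X 1 ^ dE E j
    else if i = j.succ then -MvPowerSeries.X 0
    else 0

/-- The degree matrix of `E`. -/
def degreeMatrix (E : Ideal (MvPolynomial (Fin 2) k)) :
    Matrix (Fin (tE E + 1)) (Fin (tE E)) ℤ :=
  Matrix.of fun i j => (mE E (j + 1) : ℤ) - (mE E i : ℤ) + (i : ℤ) - (j : ℤ)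

/-- The set `N(E)` of matrices over `k[[y]]` whose nonzero entries satisfy the order bounds. -/
def setN (E : Ideal (MvPolynomial (Fin 2) k)) :
    Set (Matrix (Fin (tE E + 1)) (Fin (tE E)) (PowerSeries k)) :=
  {N | ∀ (i : Fin (tE E + 1)) (j : Fin (tE E)), N i j ≠ 0 →
    (if (i : ℕ) ≤ (j : ℕ) then degreeMatrix E i j + 1 else degreeMatrix E i j) ≤
      ((N i j).order.toNat : ℤ)}

/-- The set `T₀(E)` of matrices over `k[y]`. -/
def setT0 (E : Ideal (MvPolynomial (Fin 2) k)) :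
    Set (Matrix (Fin (tE E + 1)) (Fin (tE E)) (Polynomial k)) :=
  {N | ∀ (i : Fin (tE E + 1)) (j : Fin (tE E)), ((i : ℕ) < (j : ℕ) → N i j = 0) ∧
    ((j : ℕ) ≤ (i : ℕ) → (N i j).degree < ((dE E j : ℕ) : WithBot ℕ))}

/-- The set `M(E) = N(E) ∩ T₀(E)`. -/
def setM (E : Ideal (MvPolynomial (Fin 2) k)) :
    Set (Matrix (Fin (tE E + 1)) (Fin (tE E)) (PowerSeries k)) :=
  setN E ∩ (fun N => N.map fun p : Polynomial k => (p : PowerSeries k)) '' setT0 E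

/-- The inclusion of `k[[y]]` into `k[[x, y]]`. -/
def inclY (f : PowerSeries k) : MvPowerSeries (Fin 2) k :=
  fun e => if e 0 = 0 then PowerSeries.coeff (e 1) f else 0

/-- The ideal `I_t(M)` generated by the maximal minors of a `(t + 1) × t` matrix. -/
def maxMinors {t : ℕ} (M : Matrix (Fin (t + 1)) (Fin t) (MvPowerSeries (Fin 2) k)) :
    Ideal (MvPowerSeries (Fin 2) k) :=
  Ideal.span (Set.range fun i : Fin (t + 1) => (M.submatrix i.succAbove id).det)

/-- The map `φ : N ↦ I_t(H + N)`, with `H` the canonical Hilbert-Burch matrix of `E`. -/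
def phi (E : Ideal (MvPolynomial (Fin 2) k))
    (N : Matrix (Fin (tE E + 1)) (Fin (tE E)) (PowerSeries k)) :
    Ideal (MvPowerSeries (Fin 2) k) :=
  maxMinors (canonicalHB E + N.map inclY)

/-! ### The explicit ideal -/

/-- The pair `(i, j)` violates the condition, `m_{j-1} < m_j`, and `m_i < m_{i+1}` unless
`i = t`. -/
def BadPair (E : Ideal (MvPolynomial (Fin 2) k)) (i j : ℕ) : Prop :=
  1 ≤ j ∧ j < i ∧ i ≤ tE E ∧ (mE E i : ℤ) - i < (mE E j : ℤ) - j - 1 ∧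
    mE E (j - 1) < mE E j ∧ (i = tE E ∨ mE E i < mE E (i + 1))

/-- The ideal of `k[[x, y]]` generated by `x ^ (t - l) * y ^ m_l` for `0 ≤ l ≤ t`, `l ≠ i`,
and by `x ^ (t - i) * y ^ m_i + x ^ (t - j) * y ^ (m_j - 1)`. -/
def explicitIdeal (E : Ideal (MvPolynomial (Fin 2) k)) (i j : ℕ) :
    Ideal (MvPowerSeries (Fin 2) k) :=
  Ideal.span
    ({f | ∃ l : ℕ, l ≤ tE E ∧ l ≠ i ∧
        f = MvPowerSeries.X 0 ^ (tE E - l) * MvPowerSeries.X 1 ^ mE E l} ∪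
      {MvPowerSeries.X 0 ^ (tE E - i) * MvPowerSeries.X 1 ^ mE E i +
        MvPowerSeries.X 0 ^ (tE E - j) * MvPowerSeries.X 1 ^ (mE E j - 1)})

end HilbertBurch

end

/-! Write `p` for the exponent of `x^(t-i) y^(m_i)` and `q` for that of `x^(t-j) y^(m_j-1)`. For a
bad pair, `p` is a minimal generator of `E` and `q` is a maximal monomial outside `E`. The two
orders disagree on them: `p` has smaller degree, hence is locally larger, while `q` has the larger
power of `x`, hence is lexicographically larger.

Everything rests on one linear constraint (`coeff_of_mem_explicitIdeal`): an element of the explicit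
ideal `J` is supported on `E ∪ {q}` and has equal coefficients at `p` and `q`. So `q` is never a
local leading exponent, which gives `J ∈ V(E)`; but the binomial generator is a polynomial with lex
leading monomial `q ∉ E`.

For the image of `φ`, `N ∈ T₀(E)` makes the minor of `H + N` without row `i` block triangular
(`exists_det_deformedHB`): up to sign, a monic polynomial in `y` of degree `m_i` times a
characteristic polynomial in `x` of degree `t - i`. Its coefficient at `p` is `±1`, and at `q` it is
`0` because `t - j > t - i`. The constraint fails, so this minor is not in `J`. -/

noncomputable section

namespace HilbertBurch

variable {k : Type*} [Field k]

/-! ### Exponents in two variables -/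

/-- The exponent of `x ^ a * y ^ b`. -/
def expo (a b : ℕ) : Fin 2 →₀ ℕ := Finsupp.single 0 a + Finsupp.single 1 b

@[simp] lemma expo_zero (a b : ℕ) : expo a b 0 = a := by simp [expo]

@[simp] lemma expo_one (a b : ℕ) : expo a b 1 = b := by simp [expo]

lemma ext_two {e f : Fin 2 →₀ ℕ} (h0 : e 0 = f 0) (h1 : e 1 = f 1) : e = f := by
  ext i; fin_cases i <;> assumption

lemma le_two_iff {e f : Fin 2 →₀ ℕ} : e ≤ f ↔ e 0 ≤ f 0 ∧ e 1 ≤ f 1 := by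
  rw [Finsupp.le_def, Fin.forall_fin_two]

lemma degree_two (e : Fin 2 →₀ ℕ) : e.degree = e 0 + e 1 := by
  rw [Finsupp.degree_eq_sum, Fin.sum_univ_two]

lemma toLex_lt_iff {e f : Fin 2 →₀ ℕ} :
    toLex e < toLex f ↔ e 0 < f 0 ∨ e 0 = f 0 ∧ e 1 < f 1 := by
  rw [Finsupp.Lex.lt_iff, Fin.exists_fin_two]
  simp

lemma X_pow_mul_X_pow_eq (a b : ℕ) :
    (MvPolynomial.X 0 ^ a * MvPolynomial.X 1 ^ b : MvPolynomial (Fin 2) k) =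
      MvPolynomial.monomial (expo a b) 1 := by
  simp [expo, MvPolynomial.X_pow_eq_monomial, MvPolynomial.monomial_mul]

lemma powerSeries_X_pow_mul_X_pow_eq (a b : ℕ) :
    (MvPowerSeries.X 0 ^ a * MvPowerSeries.X 1 ^ b : MvPowerSeries (Fin 2) k) =
      MvPowerSeries.monomial (expo a b) 1 := by
  simp [expo, MvPowerSeries.X_pow_eq, MvPowerSeries.monomial_mul_monomial]

/-! ### Monomial ideals -/

/-- The set of exponents of the monomials in an ideal. -/
def expSet (E : Ideal (MvPolynomial (Fin 2) k)) : Set (Fin 2 →₀ ℕ) :=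
  {e | MvPolynomial.monomial e (1 : k) ∈ E}

variable {E : Ideal (MvPolynomial (Fin 2) k)}

lemma add_mem_expSet {e : Fin 2 →₀ ℕ} (he : e ∈ expSet E) (f : Fin 2 →₀ ℕ) :
    f + e ∈ expSet E := by
  have := E.mul_mem_left (MvPolynomial.monomial f 1) he
  rwa [MvPolynomial.monomial_mul, one_mul] at this

lemma expSet_of_le {e f : Fin 2 →₀ ℕ} (he : e ∈ expSet E) (h : e ≤ f) : f ∈ expSet E := by
  have := add_mem_expSet he (f - e)
  rwa [tsub_add_cancel_of_le h] at this

lemma IsMonomialIdeal.mem_expSet (hE : IsMonomialIdeal E) {f : MvPolynomial (Fin 2) k}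
    (hf : f ∈ E) {e : Fin 2 →₀ ℕ} (he : f.coeff e ≠ 0) : e ∈ expSet E := by
  obtain ⟨S, rfl⟩ := hE
  obtain ⟨s, hs, hse⟩ :=
    MvPolynomial.mem_ideal_span_monomial_image.1 hf e (MvPolynomial.mem_support_iff.2 he)
  exact expSet_of_le (Ideal.subset_span ⟨s, hs, rfl⟩) hse

lemma IsMonomialIdeal.le_of_expSet_subset (hE : IsMonomialIdeal E)
    {I : Ideal (MvPolynomial (Fin 2) k)} (h : expSet E ⊆ expSet I) : E ≤ I := by
  obtain ⟨S, rfl⟩ := hE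
  refine Ideal.span_le.2 ?_
  rintro _ ⟨s, hs, rfl⟩
  exact h (Ideal.subset_span ⟨s, hs, rfl⟩)

/-- The quotient is Artinian, so the powers of the variable stabilise: `X^n ≡ X^(n+1) r` modulo `E`.
The difference has coefficient `1` at `X^n`, and a monomial ideal contains each monomial occurring
in its elements. -/
lemma IsMonomialIdeal.exists_X_pow_mem (hE : IsMonomialIdeal E)
    (hdim : ringKrullDim (MvPolynomial (Fin 2) k ⧸ E) = 0) (i : Fin 2) :
    ∃ n, (MvPolynomial.X i ^ n : MvPolynomial (Fin 2) k) ∈ E := by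
  have : Ring.KrullDimLE 0 (MvPolynomial (Fin 2) k ⧸ E) := by
    rw [Ring.krullDimLE_iff, hdim]; rfl
  have : IsArtinianRing (MvPolynomial (Fin 2) k ⧸ E) :=
    isArtinianRing_iff_krullDimLE_zero.2 this
  obtain ⟨n, y, hy⟩ := IsArtinian.exists_pow_succ_smul_dvd
    (Ideal.Quotient.mk E (MvPolynomial.X i)) (1 : MvPolynomial (Fin 2) k ⧸ E)
  obtain ⟨r, rfl⟩ := Ideal.Quotient.mk_surjective y
  refine ⟨n, ?_⟩
  rw [smul_eq_mul, smul_eq_mul, mul_one, ← map_pow, ← map_pow, ← map_mul, eq_comm,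
    Ideal.Quotient.eq] at hy
  have := hE.mem_expSet hy (e := Finsupp.single i n) (by
    rw [MvPolynomial.coeff_sub, MvPolynomial.X_pow_eq_monomial, MvPolynomial.X_pow_eq_monomial,
      MvPolynomial.coeff_monomial_mul']
    simp)
  rwa [MvPolynomial.X_pow_eq_monomial]

/-! ### The numerical data of a zero-dimensional monomial ideal -/

lemma mE_le_of_mem {i b : ℕ} (h : expo (tE E - i) b ∈ expSet E) : mE E i ≤ b :=
  Nat.sInf_le (by rw [Set.mem_ofPred_eq, X_pow_mul_X_pow_eq]; exact h)

lemma mem_expSet_expo_zero {a : ℕ} :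
    expo a 0 ∈ expSet E ↔ (MvPolynomial.X 0 ^ a : MvPolynomial (Fin 2) k) ∈ E := by
  rw [expSet, Set.mem_ofPred_eq, ← X_pow_mul_X_pow_eq, pow_zero, mul_one]

lemma tE_le_of_mem {a : ℕ} (h : expo a 0 ∈ expSet E) : tE E ≤ a :=
  Nat.sInf_le (mem_expSet_expo_zero.1 h)

/-- An ideal that contains a power of each variable. -/
def ContainsPowers (E : Ideal (MvPolynomial (Fin 2) k)) : Prop :=
  ∀ i, ∃ n, (MvPolynomial.X i ^ n : MvPolynomial (Fin 2) k) ∈ E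

namespace ContainsPowers

lemma expo_mE_mem (hE : ContainsPowers E) (i : ℕ) : expo (tE E - i) (mE E i) ∈ expSet E := by
  have := Nat.sInf_mem (s := {n | (MvPolynomial.X 0 ^ (tE E - i) * MvPolynomial.X 1 ^ n :
    MvPolynomial (Fin 2) k) ∈ E}) (by
      obtain ⟨n, hn⟩ := hE 1
      exact ⟨n, E.mul_mem_left _ hn⟩)
  rw [Set.mem_ofPred_eq, X_pow_mul_X_pow_eq] at this
  exact this

lemma expo_tE_mem (hE : ContainsPowers E) : expo (tE E) 0 ∈ expSet E :=
  mem_expSet_expo_zero.2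
    (Nat.sInf_mem (s := {n | (MvPolynomial.X 0 ^ n : MvPolynomial (Fin 2) k) ∈ E}) (hE 0))

lemma mE_zero (hE : ContainsPowers E) : mE E 0 = 0 :=
  Nat.le_zero.1 (mE_le_of_mem (by simpa using hE.expo_tE_mem))

/-- Truncated subtraction covers `e 0 > t` as well: the index becomes `0`, and `m_0 = 0`. -/
lemma mem_expSet_iff (hE : ContainsPowers E) (e : Fin 2 →₀ ℕ) :
    e ∈ expSet E ↔ mE E (tE E - e 0) ≤ e 1 := by
  constructor
  · intro h
    by_cases he : e 0 ≤ tE E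
    · exact mE_le_of_mem (expSet_of_le h (le_two_iff.2 ⟨by simp; omega, by simp⟩))
    · rw [show tE E - e 0 = 0 by omega, hE.mE_zero]
      exact Nat.zero_le _
  · intro h
    by_cases he : e 0 ≤ tE E
    · exact expSet_of_le (hE.expo_mE_mem (tE E - e 0))
        (le_two_iff.2 ⟨by simp only [expo_zero]; omega, by simpa only [expo_one] using h⟩)
    · exact expSet_of_le hE.expo_tE_mem
        (le_two_iff.2 ⟨by simp only [expo_zero]; omega, by simp⟩)

lemma mE_monotone (hE : ContainsPowers E) : Monotone (mE E) := by
  refine monotone_nat_of_le_succ fun i => mE_le_of_mem ?_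
  exact expSet_of_le (hE.expo_mE_mem (i + 1))
    (le_two_iff.2 ⟨by simp only [expo_zero]; omega, by simp⟩)

lemma mE_one_pos (hE : ContainsPowers E) (ht : 1 ≤ tE E) : 0 < mE E 1 := by
  by_contra! h
  have := hE.expo_mE_mem 1
  rw [Nat.le_zero.1 h] at this
  have := tE_le_of_mem this
  omega

lemma sum_dE (hE : ContainsPowers E) (i : ℕ) : ∑ j ∈ Finset.range i, dE E j = mE E i := by
  have := Finset.sum_range_tsub hE.mE_monotone i
  rw [hE.mE_zero, tsub_zero] at this
  exact this

/-- Along a plateau of `m`, decreasing `j` raises `m_j - j - 1` and increasing `i` lowers `m_i - i`,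
so the violation persists until both indices reach a jump of `m` (or `i = t`). -/
lemma exists_badPair (hE : ContainsPowers E) (h : ¬ LexGBCond E) : ∃ i j, BadPair E i j := by
  simp only [LexGBCond, not_forall, not_le] at h
  obtain ⟨i, j, hji, hit, hlt⟩ := h
  have hone := hE.mE_one_pos (by omega)
  have hzero := hE.mE_zero
  obtain ⟨j', hj'1, hj'i, hj'lt, hj'm⟩ : ∃ j', 1 ≤ j' ∧ j' < i ∧
      (mE E i : ℤ) - i < (mE E j' : ℤ) - j' - 1 ∧ mE E (j' - 1) < mE E j' := by
    induction j with
    | zero =>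
      -- A violation at `j = 0` passes to `j = 1` because `m_1 ≥ 1`; the same bound excludes `i =
      -- 1`.
      have h1i : 1 < i := by
        by_contra! h1
        obtain rfl : i = 1 := by omega
        omega
      exact ⟨1, le_rfl, h1i, by push_cast; omega, by simp; omega⟩
    | succ j ih =>
      rcases (hE.mE_monotone (Nat.le_succ j)).lt_or_eq with hm | hm
      · exact ⟨j + 1, by omega, hji, hlt, by simpa using hm⟩
      · refine ih (by omega) ?_
        rw [Nat.succ_eq_add_one] at hm
        rw [hm]; push_cast at hlt; omega
  clear hlt hji
  induction hit using Nat.decreasingInduction with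
  | self => exact ⟨tE E, j', hj'1, hj'i, le_rfl, hj'lt, hj'm, .inl rfl⟩
  | of_succ i hi ih =>
    rcases (hE.mE_monotone (Nat.le_succ i)).lt_or_eq with hm | hm
    · exact ⟨i, j', hj'1, hj'i, hi.le, hj'lt, hj'm, .inr hm⟩
    · refine ih (by omega) ?_
      rw [Nat.succ_eq_add_one] at hm
      rw [← hm]; push_cast; omega

end ContainsPowers

/-! ### The leading terms of the explicit ideal -/

/-- The power series supported on `U ∪ {q}` whose coefficients at `p` and `q` agree, when this is
an ideal: `U` is an upper set in which `p` is minimal, and `q` is maximal in its complement. -/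
def binomialIdeal (k : Type*) [Field k] (U : Set (Fin 2 →₀ ℕ)) (p q : Fin 2 →₀ ℕ)
    (hU : IsUpperSet U) (hp : ∀ e ≤ p, e ≠ p → e ∉ U) (hq : q ∉ U)
    (hqU : ∀ e, q ≤ e → e ≠ q → e ∈ U) (hqp : ¬ q ≤ p) : Ideal (MvPowerSeries (Fin 2) k) where
  carrier := {g | (∀ e ∉ U, e ≠ q → MvPowerSeries.coeff e g = 0) ∧
    MvPowerSeries.coeff q g = MvPowerSeries.coeff p g}
  add_mem' := by
    rintro f g ⟨hf, hf'⟩ ⟨hg, hg'⟩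
    refine ⟨fun e he heq => ?_, by rw [map_add, map_add, hf', hg']⟩
    rw [map_add, hf e he heq, hg e he heq, add_zero]
  zero_mem' := by simp
  smul_mem' := by
    rintro r g ⟨hg, hg'⟩
    -- If nothing strictly below `b` lies in the support of `g`, only the constant term of `r`
    -- contributes. Applied at both `p` and `q`, this scales the two coefficients by the same
    -- factor.
    have key (b : Fin 2 →₀ ℕ) (hb : ∀ e ≤ b, e ≠ b → e ∉ U ∧ e ≠ q) :
        MvPowerSeries.coeff b (r * g) = MvPowerSeries.coeff 0 r * MvPowerSeries.coeff b g := by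
      rw [MvPowerSeries.coeff_mul, Finset.sum_eq_single (0, b)]
      · rintro ⟨u, v⟩ huv hne
        rw [Finset.HasAntidiagonal.mem_antidiagonal] at huv
        subst huv
        have hv : v ≠ u + v := by
          rintro h
          have hu : u = 0 := by simpa using h.symm
          exact hne (by simp [hu])
        obtain ⟨h1, h2⟩ := hb v le_add_self hv
        rw [hg v h1 h2, mul_zero]
      · simp
    refine ⟨fun e he heq => ?_, ?_⟩
    · rw [smul_eq_mul, key, hg e he heq, mul_zero]
      refine fun v hv hne => ⟨fun h => he (hU hv h), ?_⟩
      rintro rfl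
      exact he (hqU e hv heq)
    · rw [smul_eq_mul, key, key, hg']
      · exact fun v hv hne => ⟨hp v hv hne, fun h => hqp (h ▸ hv)⟩
      · exact fun v hv hne => ⟨fun h => hq (hU hv h), hne⟩

lemma isUpperSet_expSet : IsUpperSet (expSet E) := fun _ _ h he => expSet_of_le he h

section ExplicitIdeal

variable {i j : ℕ}

lemma monomial_mem_explicitIdeal {l : ℕ} (hl : l ≤ tE E) (hli : l ≠ i) :
    MvPowerSeries.monomial (expo (tE E - l) (mE E l)) (1 : k) ∈ explicitIdeal E i j :=
  Ideal.subset_span (.inl ⟨l, hl, hli, (powerSeries_X_pow_mul_X_pow_eq _ _).symm⟩)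

lemma binomial_mem_explicitIdeal :
    MvPowerSeries.monomial (expo (tE E - i) (mE E i)) (1 : k) +
      MvPowerSeries.monomial (expo (tE E - j) (mE E j - 1)) (1 : k) ∈ explicitIdeal E i j :=
  Ideal.subset_span (.inr (by simp [powerSeries_X_pow_mul_X_pow_eq]))

lemma BadPair.not_mem_expSet (hE : ContainsPowers E) (h : BadPair E i j) :
    expo (tE E - j) (mE E j - 1) ∉ expSet E := by
  obtain ⟨hj, hji, hit, hlt, hmj, hmi⟩ := h
  rw [hE.mem_expSet_iff, expo_zero, expo_one, Nat.sub_sub_self (by omega)]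
  omega

lemma BadPair.localLT (h : BadPair E i j) :
    LocalLT (expo (tE E - j) (mE E j - 1)) (expo (tE E - i) (mE E i)) := by
  obtain ⟨hj, hji, hit, hlt, hmj, hmi⟩ := h
  left
  simp only [degree_two, expo_zero, expo_one]
  omega

lemma BadPair.toLex_lt (h : BadPair E i j) :
    toLex (expo (tE E - i) (mE E i)) < toLex (expo (tE E - j) (mE E j - 1)) := by
  obtain ⟨hj, hji, hit, hlt, hmj, hmi⟩ := h
  rw [toLex_lt_iff, expo_zero, expo_zero]
  omega

/-- It suffices to check the generators, since `binomialIdeal` is an ideal. The jump of `m` after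
`i` (or `i = t`) makes `p` minimal in `E`; the jump before `j` makes `q` maximal outside it. -/
lemma coeff_of_mem_explicitIdeal (hE : ContainsPowers E) (h : BadPair E i j)
    {g : MvPowerSeries (Fin 2) k} (hg : g ∈ explicitIdeal E i j) :
    (∀ e ∉ expSet E, e ≠ expo (tE E - j) (mE E j - 1) → MvPowerSeries.coeff e g = 0) ∧
      MvPowerSeries.coeff (expo (tE E - j) (mE E j - 1)) g =
        MvPowerSeries.coeff (expo (tE E - i) (mE E i)) g := by
  classical
  have hqU := h.not_mem_expSet hE
  have hlex := h.toLex_lt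
  obtain ⟨hj, hji, hit, hlt, hmj, hmi⟩ := h
  set p := expo (tE E - i) (mE E i) with hp
  set q := expo (tE E - j) (mE E j - 1) with hq
  have hpq : p ≠ q := fun h => hlex.ne (by rw [h])
  suffices explicitIdeal E i j ≤ binomialIdeal k (expSet E) p q isUpperSet_expSet
      (by
        intro e he hne
        rw [le_two_iff, hp, expo_zero, expo_one] at he
        rw [hE.mem_expSet_iff]
        intro hme
        have h1 : e 0 ≠ tE E - i ∨ e 1 ≠ mE E i := by
          by_contra! h
          exact hne (ext_two (by simp [hp, h.1]) (by simp [hp, h.2]))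
        have h2 := hE.mE_monotone (show i ≤ tE E - e 0 by omega)
        rcases h1 with h1 | h1
        · have h3 := hE.mE_monotone (show i + 1 ≤ tE E - e 0 by omega)
          omega
        · omega) hqU
      (by
        intro e he hne
        rw [le_two_iff, hq, expo_zero, expo_one] at he
        rw [hE.mem_expSet_iff]
        have h1 : e 0 ≠ tE E - j ∨ e 1 ≠ mE E j - 1 := by
          by_contra! h
          exact hne (ext_two (by simp [hq, h.1]) (by simp [hq, h.2]))
        have h2 := hE.mE_monotone (show tE E - e 0 ≤ j by omega)
        rcases h1 with h1 | h1
        · have h3 := hE.mE_monotone (show tE E - e 0 ≤ j - 1 by omega)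
          omega
        · omega)
      (by rw [le_two_iff]; simp only [hp, hq, expo_zero, expo_one]; omega) from this hg
  refine Ideal.span_le.2 ?_
  have hcoeff (e : Fin 2 →₀ ℕ) (he : e ∈ expSet E) (f : Fin 2 →₀ ℕ) (hf : f ∉ expSet E) :
      MvPowerSeries.coeff f (MvPowerSeries.monomial e (1 : k)) = 0 := by
    rw [MvPowerSeries.coeff_monomial, if_neg]
    rintro rfl
    exact hf he
  rintro _ (⟨l, hl, hli, rfl⟩ | rfl)
  · rw [powerSeries_X_pow_mul_X_pow_eq]
    refine ⟨fun e he _ => hcoeff _ (hE.expo_mE_mem l) e he, ?_⟩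
    rw [hcoeff _ (hE.expo_mE_mem l) q hqU, MvPowerSeries.coeff_monomial, if_neg]
    intro h
    have := congr($h 0)
    simp only [hp, expo_zero] at this
    omega
  · rw [powerSeries_X_pow_mul_X_pow_eq, powerSeries_X_pow_mul_X_pow_eq]
    refine ⟨fun e he heq => ?_, ?_⟩
    · rw [map_add, hcoeff _ (hE.expo_mE_mem i) e he, MvPowerSeries.coeff_monomial, if_neg heq,
        add_zero]
    · rw [← hp, ← hq]
      simp [MvPowerSeries.coeff_monomial, hpq, hpq.symm]

lemma LocalLT.asymm {a b : Fin 2 →₀ ℕ} (h : LocalLT a b) : ¬ LocalLT b a := by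
  rcases h with h | ⟨h, hlex⟩ <;> rintro (h' | ⟨h', hlex'⟩)
  · omega
  · omega
  · omega
  · exact lt_asymm hlex hlex'

/-- The monomial generators and the binomial, led locally by `p`, supply all generators of `E`; the
coefficient constraint rules out any further leading exponent. -/
lemma ltLocal_explicitIdeal (hmon : IsMonomialIdeal E) (hE : ContainsPowers E)
    (h : BadPair E i j) : ltLocal (explicitIdeal E i j) = E := by
  classical
  apply le_antisymm
  · refine Ideal.span_le.2 ?_
    rintro _ ⟨g, hg, a, ⟨ha, hmax⟩, rfl⟩
    by_contra haE
    obtain ⟨h1, h2⟩ := coeff_of_mem_explicitIdeal hE h hg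
    have haq : a = expo (tE E - j) (mE E j - 1) := by
      by_contra haq
      exact ha (h1 a haE haq)
    subst haq
    have hlt := h.localLT
    -- A nonzero coefficient at `q` forces one at `p`, which is locally larger than `q`.
    refine hlt.asymm (hmax _ (h2 ▸ ha) ?_)
    rintro heq
    rw [heq] at hlt
    exact hlt.asymm hlt
  · refine hmon.le_of_expSet_subset fun e he => ?_
    have hgen (l : ℕ) (hl : l ≤ tE E) :
        expo (tE E - l) (mE E l) ∈ expSet (ltLocal (explicitIdeal E i j)) := by
      by_cases hli : l = i
      · subst hli
        refine Ideal.subset_span ⟨_, binomial_mem_explicitIdeal, _, ⟨?_, ?_⟩, rfl⟩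
        · have := h.toLex_lt.ne
          rw [map_add, MvPowerSeries.coeff_monomial, MvPowerSeries.coeff_monomial, if_pos rfl,
            if_neg (fun h => this (by rw [h]))]
          simp
        · intro b hb hne
          obtain rfl : b = expo (tE E - j) (mE E j - 1) := by
            by_contra hb'
            exact hb (by simp [MvPowerSeries.coeff_monomial, hb', hne])
          exact h.localLT
      · refine Ideal.subset_span ⟨_, monomial_mem_explicitIdeal hl hli, _, ⟨?_, ?_⟩, rfl⟩
        · simp
        · intro b hb hne
          exact absurd (by simp [MvPowerSeries.coeff_monomial, hne]) hb
    rw [hE.mem_expSet_iff] at he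
    by_cases het : e 0 ≤ tE E
    · exact expSet_of_le (hgen (tE E - e 0) (by omega)) (le_two_iff.2
        ⟨by simp only [expo_zero]; omega, by simpa only [expo_one] using he⟩)
    · refine expSet_of_le (hgen 0 (by omega)) (le_two_iff.2 ⟨by simp only [expo_zero]; omega, ?_⟩)
      rw [expo_one, hE.mE_zero]
      exact Nat.zero_le _

lemma binomial_mem_contract :
    MvPolynomial.monomial (expo (tE E - i) (mE E i)) (1 : k) +
      MvPolynomial.monomial (expo (tE E - j) (mE E j - 1)) (1 : k) ∈
      contract (explicitIdeal E i j) := by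
  rw [contract, Ideal.mem_comap, map_add]
  simpa using binomial_mem_explicitIdeal (E := E) (i := i) (j := j)

lemma ltLex_contract_explicitIdeal_ne (hE : ContainsPowers E) (h : BadPair E i j) :
    ltLex (contract (explicitIdeal E i j)) ≠ E := by
  classical
  intro heq
  refine h.not_mem_expSet hE ?_
  have hlt : MonomialOrder.lex.toSyn
      (MonomialOrder.lex.degree (MvPolynomial.monomial (expo (tE E - i) (mE E i)) (1 : k))) <
      MonomialOrder.lex.toSyn (MonomialOrder.lex.degree
        (MvPolynomial.monomial (expo (tE E - j) (mE E j - 1)) (1 : k))) := by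
    rw [MonomialOrder.degree_monomial, MonomialOrder.degree_monomial, if_neg one_ne_zero,
      if_neg one_ne_zero]
    exact h.toLex_lt
  have hmem : MvPolynomial.monomial (expo (tE E - j) (mE E j - 1)) (1 : k) ∈
      ltLex (contract (explicitIdeal E i j)) := by
    refine Ideal.subset_span ⟨_, binomial_mem_contract, ?_⟩
    rw [MonomialOrder.leadingTerm, add_comm, MonomialOrder.leadingCoeff_add_of_lt hlt,
      MonomialOrder.degree_add_of_lt hlt, MonomialOrder.degree_monomial, if_neg one_ne_zero,
      MonomialOrder.leadingCoeff_monomial]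
  rwa [heq] at hmem

end ExplicitIdeal

open Polynomial

/-! ### Polynomials in `x` over `k[y]` -/

/-- The map from `k[y][x]` to `k[x, y]`. -/
def bivariate (k : Type*) [Field k] : k[X][X] →+* MvPolynomial (Fin 2) k :=
  eval₂RingHom (aeval (R := k) (MvPolynomial.X 1 : MvPolynomial (Fin 2) k)).toRingHom
    (MvPolynomial.X 0)

lemma bivariate_X : bivariate k X = MvPolynomial.X 0 := by simp [bivariate]

lemma bivariate_C_X : bivariate k (C X) = MvPolynomial.X 1 := by simp [bivariate]

lemma coeff_bivariate (G : k[X][X]) (e : Fin 2 →₀ ℕ) :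
    (bivariate k G).coeff e = (G.coeff (e 0)).coeff (e 1) := by
  classical
  induction G using Polynomial.induction_on' with
  | add p q hp hq => simp [hp, hq]
  | monomial n p =>
    induction p using Polynomial.induction_on' with
    | add p q hp hq => rw [map_add, map_add, MvPolynomial.coeff_add, hp, hq]; simp
    | monomial m c =>
      have : bivariate k (monomial n (monomial m c)) = MvPolynomial.monomial (expo n m) c := by
        have hc : bivariate k (C (C c)) = MvPolynomial.C c := by
          simp [bivariate, MvPolynomial.algebraMap_eq]
        rw [← C_mul_X_pow_eq_monomial, ← C_mul_X_pow_eq_monomial, map_mul, map_pow, map_mul,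
          map_pow, map_mul, map_pow, hc, bivariate_X, bivariate_C_X, ← mul_one c,
          ← MvPolynomial.C_mul_monomial, ← X_pow_mul_X_pow_eq, mul_one]
        ring
      rw [this, MvPolynomial.coeff_monomial, coeff_monomial]
      by_cases h0 : n = e 0
      · rw [if_pos h0, coeff_monomial]
        by_cases h1 : m = e 1
        · rw [if_pos h1, if_pos (ext_two (by simpa) (by simpa))]
        · rw [if_neg h1, if_neg]
          rintro rfl
          simp at h1
      · rw [if_neg h0, coeff_zero, if_neg]
        rintro rfl
        simp at h0

/-- The inclusion of `k[y][x]` into `k[[x, y]]`. -/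
def bivariateSeries (k : Type*) [Field k] : k[X][X] →+* MvPowerSeries (Fin 2) k :=
  (MvPolynomial.coeToMvPowerSeries.ringHom (R := k) (σ := Fin 2)).comp (bivariate k)

lemma coeff_bivariateSeries (G : k[X][X]) (e : Fin 2 →₀ ℕ) :
    MvPowerSeries.coeff e (bivariateSeries k G) = (G.coeff (e 0)).coeff (e 1) := by
  rw [← coeff_bivariate]
  simp [bivariateSeries]

lemma bivariateSeries_X : bivariateSeries k X = MvPowerSeries.X 0 := by
  simp [bivariateSeries, bivariate_X]

lemma bivariateSeries_C_X : bivariateSeries k (C X) = MvPowerSeries.X 1 := by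
  simp [bivariateSeries, bivariate_C_X]

lemma bivariateSeries_C (p : k[X]) : bivariateSeries k (C p) = inclY (p : PowerSeries k) := by
  ext e
  rw [coeff_bivariateSeries, coeff_C]
  change _ = if e 0 = 0 then PowerSeries.coeff (e 1) (p : PowerSeries k) else 0
  split_ifs <;> simp

/-! ### Maximal minors of lower triangular deformations -/

/-- The matrix over `k[y][x]` with diagonal entries `y ^ d j`, entries `-x` below the diagonal, and
`N` added. -/
def deformedHB {t : ℕ} (d : Fin t → ℕ) (N : Matrix (Fin (t + 1)) (Fin t) k[X]) :
    Matrix (Fin (t + 1)) (Fin t) k[X][X] :=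
  Matrix.of fun i j =>
    (if i = j.castSucc then C (X ^ d j) else if i = j.succ then -(X : k[X][X]) else 0) + C (N i j)

variable {t : ℕ} {d : Fin t → ℕ} {N : Matrix (Fin (t + 1)) (Fin t) k[X]}

lemma card_not_lt (i : Fin (t + 1)) : Fintype.card {j : Fin t // ¬ (j : ℕ) < i} = t - i := by
  rw [Fintype.card_subtype_compl, Fintype.card_fin, Fintype.card_subtype,
    Fin.card_filter_val_lt, min_eq_right (Nat.lt_succ_iff.1 i.2)]

/-- Without row `i`, rows above it keep `y^d + n` on the diagonal and rows below it bring `-x`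
there. Nothing lies to the right of the diagonal in the first block of rows, so the determinant
splits at column `i`. -/
lemma exists_det_deformedHB (hN : ∀ (i : Fin (t + 1)) (j : Fin t), (i : ℕ) < j → N i j = 0) (i : Fin (t + 1)) :
    ∃ A : Matrix {j : Fin t // ¬ (j : ℕ) < i} {j : Fin t // ¬ (j : ℕ) < i} k[X],
      ((deformedHB d N).submatrix i.succAbove id).det =
        C (∏ j : {j : Fin t // (j : ℕ) < i}, (X ^ d j + N j.1.castSucc j)) *
          ((-1) ^ (t - i) * A.charpoly) := by
  -- `A` is the `x`-free part of the lower block, which is therefore `-(x - A)`; the powers of `y`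
  -- now sit just above its diagonal.
  refine ⟨Matrix.of fun a b =>
    (if a.1.succ = b.1.castSucc then X ^ d b else 0) + N a.1.succ b, ?_⟩
  have hsa (a : Fin t) (ha : (a : ℕ) < i) : i.succAbove a = a.castSucc :=
    Fin.succAbove_of_castSucc_lt _ _ ha
  have hsa' (a : Fin t) (ha : ¬ (a : ℕ) < i) : i.succAbove a = a.succ :=
    Fin.succAbove_of_le_castSucc _ _ (not_lt.1 ha)
  have hzero (a b : Fin t) (hab : a < b) : deformedHB d N a.castSucc b = 0 := by
    have h1 : a.castSucc ≠ b.castSucc := fun h => hab.ne (Fin.castSucc_injective _ h)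
    have h2 : a.castSucc ≠ b.succ := fun h => by
      have := congr(($h : ℕ)); simp at this; omega
    simp [deformedHB, h1, h2, hN a.castSucc b (by simpa using hab)]
  rw [Matrix.twoBlockTriangular_det' _ fun j : Fin t => (j : ℕ) < i]
  · congr 1
    · rw [Matrix.det_of_isLowerTriangular, map_prod]
      · refine Finset.prod_congr rfl fun j _ => ?_
        simp [Matrix.toSquareBlockProp_def, hsa j.1 j.2, deformedHB]
      · intro a b hab
        simpa [Matrix.toSquareBlockProp_def, hsa a.1 a.2] using hzero a.1 b.1 hab
    · have hcard : Fintype.card {j : Fin t // ¬ (j : ℕ) < i} = t - i := by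
        rw [Fintype.card_subtype_compl, Fintype.card_fin, Fintype.card_subtype,
          Fin.card_filter_val_lt, min_eq_right (Nat.lt_succ_iff.1 i.2)]
      rw [← hcard, Matrix.charpoly, ← Matrix.det_neg]
      congr 1
      ext1 a b
      rw [Matrix.neg_apply, Matrix.charmatrix_apply]
      simp only [Matrix.toSquareBlockProp_def, Matrix.of_apply, Matrix.submatrix_apply, id_eq,
        hsa' a.1 a.2, deformedHB]
      by_cases hab : a = b
      · subst hab
        have : a.1.succ ≠ a.1.castSucc := fun h => by
          have := congr(($h : ℕ)); simp at this
        simp [this]; ring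
      · have : a.1.succ ≠ b.1.succ := fun h => hab (Subtype.ext (Fin.succ_injective _ h))
        rw [Matrix.diagonal_apply_ne _ hab, if_neg this]
        split_ifs <;> simp
  · intro a ha b hb
    rw [Matrix.submatrix_apply, hsa a ha]
    exact hzero a b (show (a : ℕ) < b by omega)

/-- The bound `deg n < d` on the diagonal keeps each factor `y^d + n` monic of degree `d`. -/
lemma exists_minor_deformedHB (hN : ∀ (i : Fin (t + 1)) (j : Fin t), (i : ℕ) < j → N i j = 0)
    (hd : ∀ j, (N j.castSucc j).degree < (d j : WithBot ℕ)) (i : Fin (t + 1)) :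
    ∃ p : k[X], ∃ c : k[X][X], p.Monic ∧ c.Monic ∧
      p.natDegree = ∑ j : {j : Fin t // (j : ℕ) < i}, d j ∧ c.natDegree = t - i ∧
      ((deformedHB d N).submatrix i.succAbove id).det = C ((-1) ^ (t - i) * p) * c := by
  obtain ⟨A, hA⟩ := exists_det_deformedHB (d := d) hN i
  have hmonic (j : {j : Fin t // (j : ℕ) < i}) :
      (X ^ d j.1 + N j.1.castSucc j.1).Monic := monic_X_pow_add (hd j)
  refine ⟨∏ j : {j : Fin t // (j : ℕ) < i}, (X ^ d j.1 + N j.1.castSucc j.1), A.charpoly,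
    monic_prod_of_monic _ _ fun j _ => hmonic j, A.charpoly_monic, ?_, ?_, ?_⟩
  · rw [natDegree_prod_of_monic _ (fun j : {j : Fin t // (j : ℕ) < i} =>
      X ^ d j.1 + N j.1.castSucc j.1) fun j _ => hmonic j]
    exact Finset.sum_congr rfl fun j _ => by
      rw [natDegree_add_eq_left_of_degree_lt (by simpa using hd j), natDegree_X_pow]
  · rw [Matrix.charpoly_natDegree_eq_dim, card_not_lt]
  · rw [hA, map_mul, map_pow, map_neg, map_one]
    ring

lemma natDegree_minor_le (hN : ∀ (i : Fin (t + 1)) (j : Fin t), (i : ℕ) < j → N i j = 0)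
    (hd : ∀ j, (N j.castSucc j).degree < (d j : WithBot ℕ)) (i : Fin (t + 1)) :
    ((deformedHB d N).submatrix i.succAbove id).det.natDegree ≤ t - i := by
  obtain ⟨p, c, -, -, -, hc, h⟩ := exists_minor_deformedHB hN hd i
  rw [h]
  exact (natDegree_C_mul_le _ _).trans hc.le

lemma coeff_minor_ne_zero (hN : ∀ (i : Fin (t + 1)) (j : Fin t), (i : ℕ) < j → N i j = 0)
    (hd : ∀ j, (N j.castSucc j).degree < (d j : WithBot ℕ)) (i : Fin (t + 1)) :
    (((deformedHB d N).submatrix i.succAbove id).det.coeff (t - i)).coeff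
      (∑ j : {j : Fin t // (j : ℕ) < i}, d j) ≠ 0 := by
  obtain ⟨p, c, hp, hcm, hpd, hc, h⟩ := exists_minor_deformedHB hN hd i
  rw [h, coeff_C_mul, ← hc, hcm.coeff_natDegree, mul_one, ← hpd,
    show ((-1) ^ c.natDegree : k[X]) = C ((-1) ^ c.natDegree) by simp, coeff_C_mul,
    hp.coeff_natDegree]
  simp

/-! ### The explicit ideal is not in the image of `φ` -/

lemma phi_coe_eq {E : Ideal (MvPolynomial (Fin 2) k)}
    (N : Matrix (Fin (tE E + 1)) (Fin (tE E)) k[X]) :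
    phi E (N.map fun p : k[X] => (p : PowerSeries k)) =
      maxMinors ((deformedHB (fun j => dE E j) N).map (bivariateSeries k)) := by
  rw [phi]
  congr 1
  ext1 i j
  simp only [canonicalHB, deformedHB, Matrix.add_apply, Matrix.map_apply, Matrix.of_apply, map_add,
    bivariateSeries_C]
  split_ifs <;> simp [bivariateSeries_X, bivariateSeries_C_X]

lemma minor_mem_maxMinors (M : Matrix (Fin (t + 1)) (Fin t) k[X][X]) (i : Fin (t + 1)) :
    bivariateSeries k (M.submatrix i.succAbove id).det ∈
      maxMinors (M.map (bivariateSeries k)) :=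
  Ideal.subset_span ⟨i, by rw [RingHom.map_det]; rfl⟩

lemma explicitIdeal_notMem_image_phi {E : Ideal (MvPolynomial (Fin 2) k)} (hE : ContainsPowers E)
    {i j : ℕ} (h : BadPair E i j) : explicitIdeal E i j ∉ phi E '' setM E := by
  rintro ⟨_, ⟨-, N, hN, rfl⟩, hphi⟩
  rw [phi_coe_eq] at hphi
  have hit : i < tE E + 1 := Nat.lt_succ_of_le h.2.2.1
  have hmem := hphi ▸ minor_mem_maxMinors (deformedHB (fun j => dE E j) N) ⟨i, hit⟩
  have hzero : ∀ (i : Fin (tE E + 1)) (j : Fin (tE E)), (i : ℕ) < j → N i j = 0 :=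
    fun i j => (hN i j).1
  have hdeg (j : Fin (tE E)) : (N j.castSucc j).degree < (dE E j : WithBot ℕ) :=
    (hN j.castSucc j).2 le_rfl
  -- Columns are numbered from `0`, so those with index below `i` carry `m_1 - m_0, …, m_i -
  -- m_(i-1)`, which telescope to `m_i`.
  have hsum : ∑ j : {j : Fin (tE E) // (j : ℕ) < i}, dE E j.1 = mE E i := by
    rw [← hE.sum_dE, ← Finset.sum_subtype (Finset.univ.filter fun j : Fin (tE E) => (j : ℕ) < i)
      (by simp) (fun j => dE E j), Finset.sum_filter,
      Fin.sum_univ_eq_sum_range (fun j => if j < i then dE E j else 0), ← Finset.sum_filter]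
    congr 1
    ext l
    simp only [Finset.mem_filter, Finset.mem_range]
    omega
  have hcoeff := (coeff_of_mem_explicitIdeal hE h hmem).2
  rw [coeff_bivariateSeries, coeff_bivariateSeries] at hcoeff
  simp only [expo_zero, expo_one] at hcoeff
  have hne := coeff_minor_ne_zero hzero hdeg ⟨i, hit⟩
  have hlt : tE E - i < tE E - j := by
    obtain ⟨-, hji, hit, -⟩ := h
    omega
  -- Membership in `J` would equate the nonzero coefficient at `p` with the one at `q`, which
  -- vanishes for reasons of `x`-degree.
  rw [hsum, ← hcoeff, coeff_eq_zero_of_natDegree_lt (n := tE E - j)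
    ((natDegree_minor_le hzero hdeg ⟨i, hit⟩).trans_lt hlt), coeff_zero] at hne
  exact hne rfl

end HilbertBurch

end

theorem mainTheorem7 {k : Type*} [Field k] (E : Ideal (MvPolynomial (Fin 2) k))
    (hmon : HilbertBurch.IsMonomialIdeal E)
    (hdim : ringKrullDim (MvPolynomial (Fin 2) k ⧸ E) = 0)
    (hE : ¬ HilbertBurch.LexGBCond E) :
    (∃ J ∈ HilbertBurch.cell E, HilbertBurch.ltLex (HilbertBurch.contract J) ≠ E) ∧
    (∃ i j : ℕ, HilbertBurch.BadPair E i j) ∧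
    (∀ i j : ℕ, HilbertBurch.BadPair E i j →
      HilbertBurch.explicitIdeal E i j ∈ HilbertBurch.cell E ∧
      HilbertBurch.ltLex (HilbertBurch.contract (HilbertBurch.explicitIdeal E i j)) ≠ E ∧
      HilbertBurch.explicitIdeal E i j ∉ HilbertBurch.phi E '' HilbertBurch.setM E) ∧
    ¬ Set.SurjOn (HilbertBurch.phi E) (HilbertBurch.setM E) (HilbertBurch.cell E) := by
  have hpow : HilbertBurch.ContainsPowers E := hmon.exists_X_pow_mem hdim
  have hcell (i j : ℕ) (h : HilbertBurch.BadPair E i j) :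
      HilbertBurch.explicitIdeal E i j ∈ HilbertBurch.cell E :=
    HilbertBurch.ltLocal_explicitIdeal hmon hpow h
  obtain ⟨i, j, hij⟩ := hpow.exists_badPair hE
  refine ⟨⟨_, hcell i j hij, HilbertBurch.ltLex_contract_explicitIdeal_ne hpow hij⟩,
    ⟨i, j, hij⟩, fun i j h => ⟨hcell i j h,
      HilbertBurch.ltLex_contract_explicitIdeal_ne hpow h,
      HilbertBurch.explicitIdeal_notMem_image_phi hpow h⟩, fun hsurj => ?_⟩
  exact HilbertBurch.explicitIdeal_notMem_image_phi hpow hij (hsurj (hcell i j hij))
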